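/- For a finite group $G$, let $D(G)$ be its quantum double over $\mathbb{C}$: the Hopf algebra with basis $g\delta_x$ ($g,x\in G$), multiplication $(g\delta_x)(h\delta_y)=gh\,\delta_y$ if $h^{-1}xh=y$ and $0$ otherwise, unit $\sum_{x\in G}\delta_x$, comultiplication $\Delta(g\delta_x)=\sum_{uv=x}g\delta_u\otimes g\delta_v$, counit $\varepsilon(g\delta_x)=1$ if $x=1$ and $0$ otherwise, and antipode $S(g\delta_x)=g^{-1}\delta_{gx^{-1}g^{-1}}$. Let $\Lambda\in D(G)$ be a left integral, i.e. $a\Lambda=\varepsilon(a)\Lambda$ for all $a\in D(G)$, with $\varepsilon(\Lambda)=1$. For an irreducible representation $V$ of $D(G)$ and $n\ge 0$, the $n$-th Frobenius--Schur indicator is $$\nu_n(V)=\mathrm{Tr}_V(\Lambda_1\cdots\Lambda_n),\qquad \Lambda_1\otimes\cdots\otimes\Lambda_n=\Delta_n(\Lambda)$$ (Sweedler notation), where $\Delta_n:D(G)\to D(G)^{\otimes n}$ is the iterated comultiplication, $\Delta_0=\varepsilon$, $\Delta_{n+1}=(\Delta_n\otimes\mathrm{id})\circ\Delta$. **Theorem.**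 Let $A$ be a finite abelian group, $N\ge 0$, and $G=S_N\ltimes A^N$, where $S_N$ permutes the coordinates of $A^N$. Then for every irreducible representation $V$ of $D(G)$ and every $n\ge 0$, the indicator $\nu_n(V)$ is a rational integer. -/

import Mathlib

open scoped TensorProduct

/-- The wreath product `S_N ⋉ A^N`, where `S_N` permutes the `N` coordinates of `A^N`. -/
abbrev WreathProduct (A : Type*) [CommGroup A] (N : ℕ) : Type _ :=
  (Fin N → A) ⋊[mulAutArrow] Equiv.Perm (Fin N)

noncomputable instance WreathProduct.instFintype (A : Type*) [CommGroup A] [Finite A] (N : ℕ) :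
    Fintype (WreathProduct A N) :=
  haveI : Finite (WreathProduct A N) := Finite.of_equiv _ SemidirectProduct.equivProd.symm
  Fintype.ofFinite _

/-- The quantum double `D(G)` of a finite group `G` over `k`: the vector space with basis
`g δ_x` for `g, x ∈ G`. The Hopf algebra structure is constructed below. -/
def QuantumDouble (k : Type*) (G : Type*) [CommRing k] : Type _ := G × G →₀ k

namespace QuantumDouble

noncomputable section

variable {k : Type*} {G : Type*} [CommRing k]

instance : AddCommGroup (QuantumDouble k G) := inferInstanceAs (AddCommGroup (G × G →₀ k))

instance : Module k (QuantumDouble k G) := inferInstanceAs (Module k (G × G →₀ k))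

/-- The basis vector `g δ_x` of the quantum double. -/
def gδ (k : Type*) {G : Type*} [CommRing k] (g x : G) : QuantumDouble k G :=
  Finsupp.single (g, x) (1 : k)

/-- The linear map with prescribed values on the basis `g δ_x`. -/
def extend {M : Type*} [AddCommGroup M] [Module k M] (f : G → G → M) :
    QuantumDouble k G →ₗ[k] M :=
  Finsupp.lsum k (fun p : G × G => LinearMap.toSpanSingleton k M (f p.1 p.2))

@[simp]
theorem extend_gδ {M : Type*} [AddCommGroup M] [Module k M] (f : G → G → M) (g x : G) :
    extend f (gδ k g x) = f g x := by
  unfold extend gδ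
  erw [Finsupp.lsum_single]
  simp

theorem hom_ext {M : Type*} [AddCommGroup M] [Module k M] {f f' : QuantumDouble k G →ₗ[k] M}
    (h : ∀ g x, f (gδ k g x) = f' (gδ k g x)) : f = f' := by
  refine Finsupp.lhom_ext' fun p => LinearMap.ext_ring ?_
  exact h p.1 p.2

theorem induction_on {p : QuantumDouble k G → Prop} (a : QuantumDouble k G)
    (zero : p 0) (basis : ∀ g x, p (gδ k g x)) (add : ∀ a b, p a → p b → p (a + b))
    (smul : ∀ (r : k) a, p a → p (r • a)) : p a := by
  refine Finsupp.induction_linear (motive := p) a ?_ add ?_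
  · exact zero
  · intro q r
    have := smul r _ (basis q.1 q.2)
    unfold gδ at this
    erw [Finsupp.smul_single, smul_eq_mul, mul_one] at this
    exact this

variable [Group G]

open Classical in
/-- The multiplication of `D(G)`, determined by `δ_x h = h δ_{h⁻¹ x h}` and
`δ_x δ_y = δ_{x,y} δ_y`: one has `(g δ_x) (h δ_y) = gh δ_y` if `h⁻¹ x h = y`, and `0` otherwise. -/
def mulHom : QuantumDouble k G →ₗ[k] QuantumDouble k G →ₗ[k] QuantumDouble k G :=
  extend fun g x => extend fun h y => if h⁻¹ * x * h = y then gδ k (g * h) y else 0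

instance : Mul (QuantumDouble k G) := ⟨fun a b => mulHom a b⟩

theorem mul_def (a b : QuantumDouble k G) : a * b = mulHom a b := rfl

open Classical in
theorem gδ_mul_gδ (g x h y : G) :
    gδ k g x * gδ k h y = if h⁻¹ * x * h = y then gδ k (g * h) y else 0 := by
  simp [mul_def, mulHom]

theorem mul_assoc' (a b c : QuantumDouble k G) : a * b * c = a * (b * c) := by
  simp only [mul_def]
  induction a using induction_on with
  | zero => simp
  | add a a' h h' => simp only [map_add, LinearMap.add_apply, h, h']
  | smul r a h => simp only [map_smul, LinearMap.smul_apply, h]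
  | basis g x =>
  induction b using induction_on with
  | zero => simp
  | add a a' h h' => simp only [map_add, LinearMap.add_apply, h, h']
  | smul r a h => simp only [map_smul, LinearMap.smul_apply, h]
  | basis h y =>
  induction c using induction_on with
  | zero => simp
  | add a a' h h' => simp only [map_add, h, h']
  | smul r a h => simp only [map_smul, h]
  | basis l z =>
  classical
  simp only [← mul_def, gδ_mul_gδ]
  by_cases h₁ : h⁻¹ * x * h = y <;> by_cases h₂ : l⁻¹ * y * l = z
  · subst h₁ h₂
    simp [gδ_mul_gδ, mul_assoc]
  · rw [if_pos h₁, if_neg h₂, gδ_mul_gδ, if_neg h₂]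
    simp [mul_def]
  · rw [if_neg h₁, if_pos h₂, gδ_mul_gδ, if_neg]
    · simp [mul_def]
    · intro h₃
      apply h₁
      rw [← h₂] at h₃
      have h₄ := congrArg (fun t => l * t * l⁻¹) h₃
      simpa [mul_assoc] using h₄
  · rw [if_neg h₁, if_neg h₂]
    simp [mul_def]

variable [Fintype G]

/-- The unit of `D(G)` is `∑ₓ δ_x`. -/
instance : One (QuantumDouble k G) := ⟨∑ x : G, gδ k 1 x⟩

theorem one_def : (1 : QuantumDouble k G) = ∑ x : G, gδ k 1 x := rfl

theorem one_mul' (a : QuantumDouble k G) : 1 * a = a := by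
  have : mulHom (1 : QuantumDouble k G) = LinearMap.id := by
    classical
    refine hom_ext fun g x => ?_
    have h : ∀ y : G, (g⁻¹ * y * g = x) ↔ y = g * x * g⁻¹ := fun y => by
      constructor
      · rintro rfl; group
      · rintro rfl; group
    simp [one_def, mulHom, h]
  exact LinearMap.congr_fun this a

theorem mul_one' (a : QuantumDouble k G) : a * 1 = a := by
  have : mulHom.flip (1 : QuantumDouble k G) = LinearMap.id := by
    classical
    refine hom_ext fun g x => ?_
    simp [one_def, mulHom]
  exact LinearMap.congr_fun this a

instance : Ring (QuantumDouble k G) :=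
  { (inferInstance : AddCommGroup (QuantumDouble k G)) with
    mul := (· * ·)
    one := 1
    left_distrib := fun a b c => by simp [mul_def]
    right_distrib := fun a b c => by simp [mul_def]
    zero_mul := fun a => by simp [mul_def]
    mul_zero := fun a => by simp [mul_def]
    mul_assoc := mul_assoc'
    one_mul := one_mul'
    mul_one := mul_one' }

instance : Algebra k (QuantumDouble k G) :=
  Algebra.ofModule (fun r a b => by simp [mul_def]) (fun r a b => by simp [mul_def])

open Classical in
/-- The coalgebra structure of `D(G)`, determined by `Δ(g) = g ⊗ g` and
`Δ(δ_x) = ∑_{uv = x} δ_u ⊗ δ_v`, `ε(g) = 1` and `ε(δ_x) = δ_{x,1}`. -/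
instance : CoalgebraStruct k (QuantumDouble k G) where
  comul := extend fun g x => ∑ u : G, gδ k g u ⊗ₜ[k] gδ k g (u⁻¹ * x)
  counit := extend fun _ x => if x = 1 then 1 else 0

theorem comul_gδ (g x : G) : Coalgebra.comul (R := k) (gδ k g x) =
    ∑ u : G, gδ k g u ⊗ₜ[k] gδ k g (u⁻¹ * x) :=
  extend_gδ _ _ _

open Classical in
theorem counit_gδ (g x : G) : Coalgebra.counit (R := k) (gδ k g x) =
    if x = 1 then (1 : k) else 0 :=
  extend_gδ _ _ _

instance : Coalgebra k (QuantumDouble k G) where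
  coassoc := hom_ext fun g x => by
    simp only [LinearMap.comp_apply, comul_gδ, map_sum, LinearMap.rTensor_tmul,
      LinearMap.lTensor_tmul, TensorProduct.sum_tmul, TensorProduct.tmul_sum,
      LinearEquiv.coe_coe, TensorProduct.assoc_tmul]
    rw [Finset.sum_comm]
    refine Finset.sum_congr rfl fun u _ => ?_
    refine Fintype.sum_equiv (Equiv.mulLeft u⁻¹) _ _ fun v => ?_
    simp [mul_assoc]
  rTensor_counit_comp_comul := hom_ext fun g x => by
    classical
    simp only [LinearMap.comp_apply, comul_gδ, map_sum, LinearMap.rTensor_tmul, counit_gδ]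
    rw [Finset.sum_eq_single 1] <;> simp +contextual
  lTensor_counit_comp_comul := hom_ext fun g x => by
    classical
    simp only [LinearMap.comp_apply, comul_gδ, map_sum, LinearMap.lTensor_tmul, counit_gδ]
    rw [Finset.sum_eq_single x]
    · simp
    · intro b _ hb
      rw [if_neg (by simpa [inv_mul_eq_one] using hb)]
      simp
    · simp

theorem counit_mul' (a b : QuantumDouble k G) : Coalgebra.counit (R := k) (a * b) =
    Coalgebra.counit (R := k) a * Coalgebra.counit (R := k) b := by
  induction a using induction_on with
  | zero => simp
  | add a a' h h' => simp only [map_add, add_mul, h, h']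
  | smul r a h => simp only [map_smul, smul_mul_assoc, h]
  | basis g x =>
  induction b using induction_on with
  | zero => simp
  | add a a' h h' => simp only [map_add, mul_add, h, h']
  | smul r a h => simp only [map_smul, mul_smul_comm, h]
  | basis h y =>
  classical
  rw [gδ_mul_gδ, counit_gδ, counit_gδ]
  by_cases hx : x = 1
  · subst hx
    by_cases hy : y = 1
    · simp [hy, counit_gδ]
    · simp [hy, Ne.symm hy]
  · by_cases hy : y = 1
    · subst hy
      have : ¬ h⁻¹ * x * h = 1 := fun e => hx (by
        have := congrArg (fun t => h * t * h⁻¹) e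
        simpa [mul_assoc] using this)
      simp [this, hx]
    · split_ifs <;> simp [counit_gδ, hy]

theorem comul_mul' (a b : QuantumDouble k G) : Coalgebra.comul (R := k) (a * b) =
    Coalgebra.comul (R := k) a * Coalgebra.comul (R := k) b := by
  induction a using induction_on with
  | zero => simp
  | add a a' h h' => simp only [map_add, add_mul, h, h']
  | smul r a h => simp only [map_smul, smul_mul_assoc, h]
  | basis g x =>
  induction b using induction_on with
  | zero => simp
  | add a a' h h' => simp only [map_add, mul_add, h, h']
  | smul r a h => simp only [map_smul, mul_smul_comm, h]
  | basis h y =>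
  classical
  rw [gδ_mul_gδ, comul_gδ, comul_gδ, Finset.sum_mul_sum]
  simp only [Algebra.TensorProduct.tmul_mul_tmul, gδ_mul_gδ]
  have key : ∀ u v : G,
      (if h⁻¹ * u * h = v then gδ k (g * h) v else 0) ⊗ₜ[k]
        (if h⁻¹ * (u⁻¹ * x) * h = v⁻¹ * y then gδ k (g * h) (v⁻¹ * y) else 0) =
      if u = h * v * h⁻¹ then (if h⁻¹ * x * h = y then
        gδ k (g * h) v ⊗ₜ[k] gδ k (g * h) (v⁻¹ * y) else 0) else 0 := by
    intro u v
    by_cases hu : u = h * v * h⁻¹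
    · subst hu
      have e₁ : h⁻¹ * (h * v * h⁻¹) * h = v := by group
      have e₂ : h⁻¹ * ((h * v * h⁻¹)⁻¹ * x) * h = v⁻¹ * (h⁻¹ * x * h) := by group
      rw [e₁, e₂]
      by_cases hy : h⁻¹ * x * h = y <;> simp [hy]
    · have : ¬ h⁻¹ * u * h = v := fun e => hu (by rw [← e]; group)
      simp [hu, this]
  simp only [key]
  rw [Finset.sum_comm]
  simp only [Finset.sum_ite_eq', Finset.mem_univ, if_true]
  by_cases hy : h⁻¹ * x * h = y
  · simp [hy, comul_gδ]
  · simp [hy]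

instance : Bialgebra k (QuantumDouble k G) :=
  Bialgebra.mk' k _
    (by
      classical
      simp [one_def, counit_gδ])
    (counit_mul' _ _)
    (by
      simp only [one_def, map_sum, comul_gδ, Algebra.TensorProduct.one_def,
        TensorProduct.sum_tmul, TensorProduct.tmul_sum]
      rw [Finset.sum_comm]
      conv_rhs => rw [Finset.sum_comm]
      refine Finset.sum_congr rfl fun u _ => ?_
      exact Fintype.sum_equiv (Equiv.mulLeft u⁻¹) _ _ fun v => rfl)
    (comul_mul' _ _)

/-- The antipode of `D(G)`: `S(g δ_x) = δ_{x⁻¹} g⁻¹ = g⁻¹ δ_{g x⁻¹ g⁻¹}`. -/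
instance : HopfAlgebra k (QuantumDouble k G) where
  antipode := extend fun g x => gδ k g⁻¹ (g * x⁻¹ * g⁻¹)
  mul_antipode_rTensor_comul := hom_ext fun g x => by
    classical
    simp only [LinearMap.comp_apply, comul_gδ, map_sum, LinearMap.rTensor_tmul, extend_gδ,
      LinearMap.mul'_apply, gδ_mul_gδ, counit_gδ]
    by_cases hx : x = 1
    · subst hx
      simp [mul_assoc, one_def]
      exact Fintype.sum_equiv (Equiv.inv G) _ _ fun v => rfl
    · have : ∀ u : G, ¬ g⁻¹ * (g * u⁻¹ * g⁻¹) * g = u⁻¹ * x := fun u e => hx (by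
        simpa [mul_assoc] using e)
      simp [hx, this]
  mul_antipode_lTensor_comul := hom_ext fun g x => by
    classical
    simp only [LinearMap.comp_apply, comul_gδ, map_sum, LinearMap.lTensor_tmul, extend_gδ,
      LinearMap.mul'_apply, gδ_mul_gδ, counit_gδ]
    by_cases hx : x = 1
    · subst hx
      simp [mul_assoc, one_def]
      exact Fintype.sum_equiv (MulAut.conj g).toEquiv _ _ fun v => by simp [mul_assoc]
    · have : ∀ u : G, ¬ g⁻¹⁻¹ * u * g⁻¹ = g * (u⁻¹ * x)⁻¹ * g⁻¹ := fun u e => hx (by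
        simpa [mul_assoc] using e)
      simp only [if_neg (this _), hx]
      simp

end

end QuantumDouble

section Indicators

variable (k : Type*) [CommRing k] {H : Type*} [Ring H] [HopfAlgebra k H]

/-- `Λ ∈ H` is a left integral if `h Λ = ε(h) Λ` for all `h ∈ H`. -/
def IsLeftIntegral (Λ : H) : Prop :=
  ∀ h : H, h * Λ = Coalgebra.counit (R := k) h • Λ

/-- The iterated comultiplication `Δ_n : H → H^{⊗n}`, with `Δ_0 = ε` and
`Δ_{n+1} = (Δ_n ⊗ id) ∘ Δ`; in particular `Δ_1 = id` and `Δ_2 = Δ`. -/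
noncomputable def iteratedComul : (n : ℕ) → H →ₗ[k] ⨂[k]^n H
  | 0 => (TensorPower.algebraMap₀ (R := k) (M := H)).toLinearMap ∘ₗ Coalgebra.counit
  | n + 1 => (TensorPower.mulEquiv (R := k) (M := H) (n := n) (m := 1)).toLinearMap ∘ₗ
      TensorProduct.map (iteratedComul n)
        (PiTensorProduct.subsingletonEquiv (R := k) (s := fun _ : Fin 1 => H) 0).symm.toLinearMap
      ∘ₗ Coalgebra.comul

/-- The multiplication `H^{⊗n} → H`, `h_1 ⊗ ⋯ ⊗ h_n ↦ h_1 ⋯ h_n`. -/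
noncomputable def iteratedMul (n : ℕ) : ⨂[k]^n H →ₗ[k] H :=
  PiTensorProduct.lift (MultilinearMap.mkPiAlgebraFin k n H)

/-- The Frobenius-Schur indicator `ν_n(V) = Tr_V(Λ_1 ⋯ Λ_n)` of an `H`-module `V`, where
`Λ_1 ⊗ ⋯ ⊗ Λ_n = Δ_n(Λ)`; here `Λ` is meant to be a left integral with `ε(Λ) = 1`. -/
noncomputable def frobeniusSchurIndicator (Λ : H) (V : Type*) [AddCommGroup V] [Module k V]
    [Module H V] [IsScalarTower k H V] (n : ℕ) : k :=
  LinearMap.trace k V (Algebra.lsmul k k V (iteratedMul k n (iteratedComul k n Λ)))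

end Indicators

/-- The normalized left integral of `D(G)` is `|G|⁻¹ (∑_g g) δ_1`. -/
theorem QuantumDouble.exists_isLeftIntegral (G : Type*) [Group G] [Fintype G] :
    ∃ Λ : QuantumDouble ℂ G, IsLeftIntegral ℂ Λ ∧ Coalgebra.counit (R := ℂ) Λ = 1 := by
  classical
  refine ⟨(Fintype.card G : ℂ)⁻¹ • ∑ g : G, gδ ℂ g 1, fun a => ?_, ?_⟩
  · rw [mul_smul_comm, smul_comm]
    congr 1
    induction a using induction_on with
    | zero => simp
    | add a a' h h' => simp only [map_add, add_mul, add_smul, h, h']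
    | smul r a h => simp only [map_smul, smul_mul_assoc, smul_assoc, h]
    | basis g x =>
    rw [Finset.mul_sum, counit_gδ]
    simp only [gδ_mul_gδ]
    by_cases hx : x = 1
    · subst hx
      simp only [mul_one, inv_mul_cancel, if_true, one_smul]
      exact Fintype.sum_equiv (Equiv.mulLeft g) _ _ fun v => rfl
    · have : ∀ h : G, ¬ h⁻¹ * x * h = 1 := fun h e => hx (by
        have := congrArg (fun t => h * t * h⁻¹) e
        simpa [mul_assoc] using this)
      simp [hx, this]
  · simp [counit_gδ]

/-!
By left and right integrality `|G| Λ = ∑ g, g δ₁`, so `|G| ν_n(V)` is the sum over `y` and `z` of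
`Tr_V(z δ_y)` times the number of common `n`-th roots of `z` among `a` and `y⁻¹ a`.

*Integrality.* By the cyclic symmetry of the trace, the trace of the Sweedler power of `g δ₁` is the
trace on `V^{⊗n}` of `Δ_n(g δ₁)` composed with the rotation of the factors. Averaging over `g` gives
a projection commuting with the rotation, whose composite with it has for eigenvalues zero and
roots of unity.

*Rationality.* Suppose that the number of common roots depends only on `y` and on the cyclic
subgroup generated by `z`. The sum of `Tr_V(z δ_y)` over the elements `z` of a subgroup is rational,
because `∑ z, z δ_y` is a multiple of an idempotent, and by induction so is the sum over the
generators of a cyclic subgroup.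

*Counting roots.* `S_N ⋉ A^N` is the centralizer of the translations among the permutations of
`N` copies of `A`. In the centralizer of a commuting set `D` of permutations of a finite set `X`, an
equality `a ^ n = (y a) ^ n = z` makes `a` and `y a` commute with the abelian group `Γ` generated by
`D` and `z`, hence permute its orbits. Multiplying `a` by a permutation that acts on each orbit as a
well-chosen element of `Γ` turns the common `n`-th roots of `z` injectively into those of
`z ^ (c + 1)`. Taking that element to be a power of one depending only on the stabilizer, the choice
amounts to finding an integer function `e` on the set of orbits with prescribed sums over `n` steps
along two permutations at once. Each of the two problems can be solved on its own, and the
difference of the two solutions is orthogonal to the functions invariant under both permutations,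
so it is a sum of two coboundaries, one for each permutation.
-/

section BirkhoffSums

variable {Y : Type*} {α β : Equiv.Perm Y} {n : ℕ}

theorem birkhoffSum_apply_of_pow_eq_one {M : Type*} [AddCommGroup M] (hα : α ^ n = 1)
    (e : Y → M) (p : Y) : birkhoffSum α e n (α p) = birkhoffSum α e n p := by
  rw [← sub_eq_zero, birkhoffSum_apply_sub_birkhoffSum, Equiv.Perm.iterate_eq_pow, hα,
    Equiv.Perm.one_apply, sub_self]

theorem sum_mul_birkhoffSum [Fintype Y] {R : Type*} [CommSemiring R] {f : Y → R} (hf : f ∘ α = f)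
    (e : Y → R) (n : ℕ) : ∑ p, f p * birkhoffSum α e n p = n * ∑ p, f p * e p := by
  have hterm (j : ℕ) : ∑ p, f p * e (α^[j] p) = ∑ p, f p * e p := by
    have hfj (p : Y) : f ((α ^ j) p) = f p := by
      rw [← Equiv.Perm.iterate_eq_pow]
      exact congrFun (Function.iterate_invariant hf j) p
    rw [← Equiv.sum_comp (α ^ j) fun p => f p * e p]
    simp only [hfj, Equiv.Perm.iterate_eq_pow]
  simp only [birkhoffSum, Finset.mul_sum (ι := ℕ)]
  rw [Finset.sum_comm]
  simp only [hterm, Finset.sum_const, Finset.card_range, nsmul_eq_mul]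

theorem birkhoffSum_eq_div_minimalPeriod_nsmul {M : Type*} [AddCommGroup M] (hα : α ^ n = 1)
    {e : Y → M} {p : Y} (he : ∀ j, α^[j] p ≠ p → e (α^[j] p) = 0) :
    birkhoffSum α e n p = (n / Function.minimalPeriod α p) • e p := by
  classical
  have hterm (j : ℕ) : e (α^[j + 1] p) =
      if Function.minimalPeriod α p ∣ j + 1 then e p else 0 := by
    split_ifs with h
    · rw [(Function.isPeriodicPt_iff_minimalPeriod_dvd.2 h).eq]
    · exact he _ fun hp => h (Function.isPeriodicPt_iff_minimalPeriod_dvd.1 hp)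
  rw [← birkhoffSum_apply_of_pow_eq_one hα, birkhoffSum]
  simp only [← Function.iterate_succ_apply, hterm]
  rw [← Finset.sum_filter, Finset.sum_const, Nat.card_multiples]

theorem exists_birkhoffSum_eq [Finite Y] (hα : α ^ n = 1) {L : Y → ℤ} (hLα : L ∘ α = L)
    (hL : ∀ p, ((n / Function.minimalPeriod α p : ℕ) : ℤ) ∣ L p) :
    ∃ e : Y → ℤ, birkhoffSum α e n = L := by
  classical
  let r (p : Y) : Y := (Quotient.mk (Equiv.Perm.SameCycle.setoid α) p).out
  have hr (p : Y) : α.SameCycle p (r p) :=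
    Equiv.Perm.SameCycle.symm (Quotient.mk_out (s := Equiv.Perm.SameCycle.setoid α) p)
  have hrα (j : ℕ) (p : Y) : r (α^[j] p) = r p := by
    have hj : α.SameCycle (α^[j] p) p := by
      rw [Equiv.Perm.iterate_eq_pow, Equiv.Perm.sameCycle_pow_left]
    exact congrArg Quotient.out (Quotient.sound (s := Equiv.Perm.SameCycle.setoid α) hj)
  let e (p : Y) : ℤ := if r p = p then L p / (n / Function.minimalPeriod α p : ℕ) else 0
  have he {p : Y} (hp : r p = p) : birkhoffSum α e n p = L p := by
    rw [birkhoffSum_eq_div_minimalPeriod_nsmul hα, nsmul_eq_mul]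
    · simp only [e, hp, if_true]
      exact Int.mul_ediv_cancel' (hL p)
    · intro j hj
      simp only [e, hrα, hp]
      exact if_neg hj.symm
  refine ⟨e, funext fun p => ?_⟩
  obtain ⟨i, hi⟩ := (hr p).exists_nat_pow_eq
  rw [← Equiv.Perm.iterate_eq_pow] at hi
  have hsum : birkhoffSum α e n ∘ α = birkhoffSum α e n :=
    funext (birkhoffSum_apply_of_pow_eq_one hα e)
  calc birkhoffSum α e n p = birkhoffSum α e n (r p) := by
        rw [← hi]; exact (congrFun (Function.iterate_invariant hsum i) p).symm
    _ = L (r p) := he (by rw [← hi, hrα, hi])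
    _ = L p := by rw [← hi]; exact congrFun (Function.iterate_invariant hLα i) p

/-- The operator `g ↦ g - g ∘ α`, whose values have vanishing sums over the cycles of `α`. -/
def coboundary (α : Equiv.Perm Y) : (Y → ℤ) →ₗ[ℤ] (Y → ℤ) :=
  LinearMap.id - LinearMap.funLeft ℤ ℤ α

theorem coboundary_apply (g : Y → ℤ) : coboundary α g = g - g ∘ α := rfl

theorem birkhoffSum_coboundary (hα : α ^ n = 1) (g : Y → ℤ) :
    birkhoffSum α (coboundary α g) n = 0 := by
  ext p
  have hsum := Finset.sum_range_sub' (fun j => g (α^[j] p)) n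
  rw [Equiv.Perm.iterate_eq_pow α n, hα] at hsum
  simpa [birkhoffSum, coboundary_apply, Function.iterate_succ_apply'] using hsum

theorem single_sub_single_mem_range_coboundary [DecidableEq Y] {γ : Equiv.Perm Y}
    (hγ : γ ∈ Subgroup.closure {α, β}) (q : Y) :
    (Pi.single (γ q) 1 - Pi.single q 1 : Y → ℤ) ∈
      (coboundary α).range ⊔ (coboundary β).range := by
  have hgen (δ : Equiv.Perm Y) (q : Y) :
      (Pi.single (δ q) 1 - Pi.single q 1 : Y → ℤ) = coboundary δ (Pi.single (δ q) 1) := by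
    ext p
    simp [coboundary_apply, Pi.single_apply]
  induction hγ using Subgroup.closure_induction generalizing q with
  | mem δ hδ =>
    rw [hgen]
    rcases hδ with rfl | rfl
    · exact Submodule.mem_sup_left ⟨_, rfl⟩
    · exact Submodule.mem_sup_right ⟨_, rfl⟩
  | one => simp
  | mul γ γ' _ _ hγ hγ' => simpa using add_mem (hγ (γ' q)) (hγ' q)
  | inv γ _ hγ => simpa using neg_mem (hγ (γ⁻¹ q))

/-- The invariant functions detect the coinvariants of `ℤ^Y`: a function orthogonal to all of them
is a combination of the differences between the indicators of a point and of a representative of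
its orbit. -/
theorem mem_range_coboundary_sup_of_sum_mul_eq_zero [Fintype Y] {h : Y → ℤ}
    (hh : ∀ f : Y → ℤ, f ∘ α = f → f ∘ β = f → ∑ p, f p * h p = 0) :
    h ∈ (coboundary α).range ⊔ (coboundary β).range := by
  classical
  let Δ : Subgroup (Equiv.Perm Y) := Subgroup.closure {α, β}
  let r (p : Y) : Y := (Quotient.mk (MulAction.orbitRel Δ Y) p).out
  have hr {δ : Equiv.Perm Y} (hδ : δ ∈ Δ) (p : Y) : r (δ p) = r p :=
    congrArg Quotient.out (Quotient.sound (s := MulAction.orbitRel Δ Y)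
      (MulAction.mem_orbit p (⟨δ, hδ⟩ : Δ)))
  have hα : α ∈ Δ := Subgroup.subset_closure (by simp)
  have hβ : β ∈ Δ := Subgroup.subset_closure (by simp)
  have hsum : ∑ q, h q • (Pi.single (r q) 1 : Y → ℤ) = 0 := by
    ext p
    have := hh (fun q => if r q = p then 1 else 0) (by ext; simp [hr hα]) (by ext; simp [hr hβ])
    simpa [Pi.single_apply, eq_comm] using this
  have hdecomp : h = ∑ q, h q • (Pi.single q 1 - Pi.single (r q) 1 : Y → ℤ) := by
    simp only [smul_sub, Finset.sum_sub_distrib, hsum, sub_zero]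
    ext p
    simp [Pi.single_apply]
  rw [hdecomp]
  refine sum_mem fun q _ => Submodule.smul_mem _ _ ?_
  obtain ⟨⟨δ, hδ⟩, hq⟩ : q ∈ MulAction.orbit Δ (r q) :=
    MulAction.mem_orbit_symm.1 (Quotient.mk_out (s := MulAction.orbitRel Δ Y) q)
  have hq : δ (r q) = q := hq
  simpa only [hq] using single_sub_single_mem_range_coboundary hδ (r q)

theorem exists_common_birkhoffSum_eq [Finite Y] (hn : n ≠ 0) (hα : α ^ n = 1) (hβ : β ^ n = 1)
    {L : Y → ℤ} (hLα : L ∘ α = L) (hLβ : L ∘ β = L)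
    (hdα : ∀ p, ((n / Function.minimalPeriod α p : ℕ) : ℤ) ∣ L p)
    (hdβ : ∀ p, ((n / Function.minimalPeriod β p : ℕ) : ℤ) ∣ L p) :
    ∃ e : Y → ℤ, birkhoffSum α e n = L ∧ birkhoffSum β e n = L := by
  have := Fintype.ofFinite Y
  obtain ⟨a, ha⟩ := exists_birkhoffSum_eq hα hLα hdα
  obtain ⟨b, hb⟩ := exists_birkhoffSum_eq hβ hLβ hdβ
  have horth (f : Y → ℤ) (hfα : f ∘ α = f) (hfβ : f ∘ β = f) : ∑ p, f p * (a - b) p = 0 := by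
    have h : (n : ℤ) * ∑ p, f p * a p = n * ∑ p, f p * b p := by
      rw [← sum_mul_birkhoffSum hfα, ← sum_mul_birkhoffSum hfβ, ha, hb]
    simp only [Pi.sub_apply, mul_sub, Finset.sum_sub_distrib, sub_eq_zero]
    exact mul_left_cancel₀ (Nat.cast_ne_zero.2 hn) h
  obtain ⟨_, ⟨g, rfl⟩, _, ⟨g', rfl⟩, hg⟩ :=
    Submodule.mem_sup.1 (mem_range_coboundary_sup_of_sum_mul_eq_zero horth)
  have hab : a - coboundary α g = b + coboundary β g' := by
    rw [sub_eq_iff_eq_add, add_assoc, add_comm (coboundary β g'), hg, add_sub_cancel]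
  refine ⟨a - coboundary α g, ?_, ?_⟩
  · ext p
    rw [birkhoffSum_sub, ha, birkhoffSum_coboundary hα, Pi.zero_apply, sub_zero]
  · ext p
    rw [hab, birkhoffSum_add', hb, birkhoffSum_coboundary hβ, Pi.zero_apply, add_zero]

end BirkhoffSums

section Roots

theorem prod_zpow_eq_zpow_sum {B ι : Type*} [CommGroup B] (s : Finset ι) (w : B) (e : ι → ℤ) :
    ∏ i ∈ s, w ^ e i = w ^ ∑ i ∈ s, e i :=
  (map_prod (zpowersHom B w) (fun i => Multiplicative.ofAdd (e i)) s).symm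

theorem exists_pow_lcm_eq {B : Type*} [CommGroup B] {z w w' : B} {m m' : ℕ} (h : w ^ m = z)
    (h' : w' ^ m' = z) : ∃ W : B, W ^ m.lcm m' = z := by
  rcases eq_or_ne (m.gcd m') 0 with hg | hg
  · have hm : m = 0 := (Nat.gcd_eq_zero_iff.1 hg).1
    exact ⟨1, by rw [one_pow, ← h, hm, pow_zero]⟩
  obtain ⟨q, hq⟩ := Nat.gcd_dvd_left m m'
  obtain ⟨q', hq'⟩ := Nat.gcd_dvd_right m m'
  have hlcm : m.lcm m' = m * q' := by
    refine Nat.eq_of_mul_eq_mul_left (Nat.pos_of_ne_zero hg) ?_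
    rw [Nat.gcd_mul_lcm, mul_left_comm, ← hq']
  have hlcm' : m.lcm m' = m' * q := by
    refine Nat.eq_of_mul_eq_mul_left (Nat.pos_of_ne_zero hg) ?_
    rw [Nat.gcd_mul_lcm, mul_left_comm, ← hq, mul_comm]
  have hbezout : (q : ℤ) * m.gcdA m' + q' * m.gcdB m' = 1 := by
    refine mul_left_cancel₀ (Int.natCast_ne_zero.2 hg) ?_
    rw [mul_one, mul_add, ← mul_assoc, ← mul_assoc, ← Nat.cast_mul, ← Nat.cast_mul, ← hq, ← hq']
    exact (Nat.gcd_eq_gcd_ab m m').symm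
  refine ⟨w' ^ m.gcdA m' * w ^ m.gcdB m', ?_⟩
  calc (w' ^ m.gcdA m' * w ^ m.gcdB m') ^ m.lcm m'
      = (w' ^ m') ^ (q * m.gcdA m' : ℤ) * (w ^ m) ^ (q' * m.gcdB m' : ℤ) := by
        rw [mul_pow]
        nth_rw 1 [hlcm']
        rw [hlcm]
        simp only [← zpow_natCast, ← zpow_mul, Nat.cast_mul]
        congr 2 <;> ring
    _ = z := by rw [h, h', ← zpow_add, hbezout, zpow_one]

theorem exists_pow_finset_lcm_eq {B ι : Type*} [CommGroup B] (s : Finset ι) (m : ι → ℕ) (z : B)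
    (h : ∀ i ∈ s, ∃ w : B, w ^ m i = z) : ∃ W : B, W ^ s.lcm m = z := by
  classical
  induction s using Finset.induction_on with
  | empty => exact ⟨z, by simp⟩
  | insert i s _ ih =>
    obtain ⟨w, hw⟩ := h i (Finset.mem_insert_self i s)
    obtain ⟨w', hw'⟩ := ih fun j hj => h j (Finset.mem_insert_of_mem hj)
    rw [Finset.lcm_insert]
    exact exists_pow_lcm_eq hw hw'

theorem exists_pow_eq_and_forall_dvd {B : Type*} [CommGroup B] {n : ℕ} (hn : n ≠ 0) (z : B) :
    ∃ (w : B) (L : ℕ), w ^ L = z ∧ ∀ m : ℕ, m ∣ n → (∃ v : B, v ^ m = z) → m ∣ L := by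
  classical
  let s := n.divisors.filter fun m => ∃ v : B, v ^ m = z
  obtain ⟨w, hw⟩ := exists_pow_finset_lcm_eq s id z fun m hm => (Finset.mem_filter.1 hm).2
  refine ⟨w, s.lcm id, hw, fun m hm hv => ?_⟩
  exact Finset.dvd_lcm (f := id) (Finset.mem_filter.2 ⟨Nat.mem_divisors.2 ⟨hm, hn⟩, hv⟩)

end Roots

section OrbitTwists

variable {Γ H X : Type*} [CommGroup Γ] [Group H] [MulAction Γ X] [MulAction H X]

theorem pow_smul_eq_pow_smul [SMulCommClass H Γ X] {a : H} {s : Γ} {x : X} (h : a • x = s • x)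
    (m : ℕ) : a ^ m • x = s ^ m • x := by
  induction m with
  | zero => simp
  | succ m ih => rw [pow_succ', mul_smul, ih, smul_comm, h, smul_smul, pow_succ]

theorem stabilizer_smul_eq_of_smulCommClass [SMulCommClass H Γ X] (a : H) (x : X) :
    MulAction.stabilizer Γ (a • x) = MulAction.stabilizer Γ x := by
  ext c
  rw [MulAction.mem_stabilizer_iff, MulAction.mem_stabilizer_iff, ← smul_comm a c,
    (MulAction.injective a).eq_iff]

/-- Passing to the quotients `Γ ⧸ B`, the exponent depends only on the stabilizer of the point. -/
theorem exists_pow_smul_eq_and_forall_dvd (X : Type*) [MulAction Γ X] {n : ℕ} (hn : n ≠ 0)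
    (z : Γ) : ∃ (w : Subgroup Γ → Γ) (L : Subgroup Γ → ℕ), ∀ x : X,
      w (MulAction.stabilizer Γ x) ^ L (MulAction.stabilizer Γ x) • x = z • x ∧
      ∀ m : ℕ, m ∣ n → (∃ v : Γ, v ^ m • x = z • x) → m ∣ L (MulAction.stabilizer Γ x) := by
  have hroot (B : Subgroup Γ) := exists_pow_eq_and_forall_dvd hn (z : Γ ⧸ B)
  choose W L hW hL using hroot
  have hsmul (u : Γ) (x : X) : (u : Γ ⧸ MulAction.stabilizer Γ x) = z ↔ u • x = z • x := by
    rw [QuotientGroup.eq, MulAction.mem_stabilizer_iff, mul_smul, inv_smul_eq_iff, eq_comm]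
  refine ⟨fun B => (W B).out, L, fun x => ⟨?_, fun m hm ⟨v, hv⟩ => ?_⟩⟩
  · rw [← hsmul, QuotientGroup.mk_pow, QuotientGroup.out_eq', hW]
  · exact hL _ m hm ⟨v, by rw [← QuotientGroup.mk_pow, hsmul, hv]⟩

variable (Γ) in
/-- The `Γ`-orbit of a point, as a point of the orbit space. -/
def orbitClass (x : X) : MulAction.orbitRel.Quotient Γ X := Quotient.mk'' x

theorem orbitClass_eq_iff {x x' : X} : orbitClass Γ x = orbitClass Γ x' ↔ ∃ c : Γ, c • x' = x :=
  Quotient.eq''.trans MulAction.mem_orbit_iff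

@[simp]
theorem orbitClass_smul (c : Γ) (x : X) : orbitClass Γ (c • x) = orbitClass Γ x :=
  orbitClass_eq_iff.2 ⟨c, rfl⟩

/-- The common stabilizer of the points of an orbit of a commutative group. -/
def orbitStabilizer (y : MulAction.orbitRel.Quotient Γ X) : Subgroup Γ :=
  Quotient.liftOn' y (MulAction.stabilizer Γ) fun _ _ h => by
    obtain ⟨c, rfl⟩ := MulAction.mem_orbit_iff.1 h
    exact stabilizer_smul_eq_of_smulCommClass c _

theorem orbitStabilizer_orbitClass (x : X) :
    orbitStabilizer (orbitClass Γ x) = MulAction.stabilizer Γ x := rfl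

/-- The permutation of `X` acting on each orbit `y` of `Γ` as the element `k y`. -/
def orbitTwist (k : MulAction.orbitRel.Quotient Γ X → Γ) : Equiv.Perm X where
  toFun x := k (orbitClass Γ x) • x
  invFun x := (k (orbitClass Γ x))⁻¹ • x
  left_inv x := by simp
  right_inv x := by simp

theorem orbitTwist_apply (k : MulAction.orbitRel.Quotient Γ X → Γ) (x : X) :
    orbitTwist k x = k (orbitClass Γ x) • x := rfl

theorem orbitTwist_smul (k : MulAction.orbitRel.Quotient Γ X → Γ) (c : Γ) (x : X) :
    orbitTwist k (c • x) = c • orbitTwist k x := by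
  rw [orbitTwist_apply, orbitTwist_apply, orbitClass_smul, smul_comm]

variable [SMulCommClass H Γ X]

variable (Γ H X) in
/-- The action on the orbits of `Γ` of a group whose action commutes with the one of `Γ`. -/
def orbitPermHom : H →* Equiv.Perm (MulAction.orbitRel.Quotient Γ X) where
  toFun a := Quotient.congr (MulAction.toPerm a) fun x x' => by
    change x ∈ MulAction.orbit Γ x' ↔ a • x ∈ MulAction.orbit Γ (a • x')
    simp only [MulAction.mem_orbit_iff, ← smul_comm a, smul_left_cancel_iff]
  map_one' := by
    ext ⟨x⟩
    exact congrArg (orbitClass Γ) (one_smul H x)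
  map_mul' a b := by
    ext ⟨x⟩
    exact congrArg (orbitClass Γ) (mul_smul a b x)

theorem orbitPermHom_orbitClass (a : H) (x : X) :
    orbitPermHom Γ H X a (orbitClass Γ x) = orbitClass Γ (a • x) := rfl

theorem orbitPermHom_iterate_orbitClass (a : H) (j : ℕ) (x : X) :
    (orbitPermHom Γ H X a)^[j] (orbitClass Γ x) = orbitClass Γ (a ^ j • x) := by
  rw [Equiv.Perm.iterate_eq_pow, ← map_pow, orbitPermHom_orbitClass]

theorem orbitStabilizer_comp_orbitPermHom (a : H) :
    orbitStabilizer ∘ orbitPermHom Γ H X a = orbitStabilizer := by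
  ext1 ⟨x⟩
  exact stabilizer_smul_eq_of_smulCommClass a x

theorem orbitPermHom_pow_eq_one {a : H} {n : ℕ} {z : Γ} (ha : ∀ x : X, a ^ n • x = z • x) :
    orbitPermHom Γ H X a ^ n = 1 := by
  ext ⟨x⟩
  rw [← map_pow]
  exact (congrArg (orbitClass Γ) (ha x)).trans (orbitClass_smul z x)

theorem minimalPeriod_orbitPermHom_dvd {a : H} {n : ℕ} {z : Γ}
    (ha : ∀ x : X, a ^ n • x = z • x) (y : MulAction.orbitRel.Quotient Γ X) :
    Function.minimalPeriod (orbitPermHom Γ H X a) y ∣ n :=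
  Function.isPeriodicPt_iff_minimalPeriod_dvd.1
    (DFunLike.congr_fun (orbitPermHom_pow_eq_one ha) y)

theorem exists_pow_div_minimalPeriod_smul_eq {a : H} {n : ℕ} {z : Γ}
    (ha : ∀ x : X, a ^ n • x = z • x) (x : X) : ∃ s : Γ,
      s ^ (n / Function.minimalPeriod (orbitPermHom Γ H X a) (orbitClass Γ x)) • x = z • x := by
  set d := Function.minimalPeriod (orbitPermHom Γ H X a) (orbitClass Γ x)
  have hd : d ∣ n := minimalPeriod_orbitPermHom_dvd ha _
  obtain ⟨s, hs⟩ : ∃ s : Γ, s • x = a ^ d • x := by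
    rw [← orbitClass_eq_iff, ← orbitPermHom_iterate_orbitClass]
    exact Function.iterate_minimalPeriod
  refine ⟨s, ?_⟩
  rw [← pow_smul_eq_pow_smul hs.symm, ← pow_mul, Nat.mul_div_cancel' hd, ha]

theorem smul_orbitTwist_pow_apply (a : H) (k : MulAction.orbitRel.Quotient Γ X → Γ) (i : ℕ)
    (x : X) : (((MulAction.toPerm a : Equiv.Perm X) * orbitTwist k) ^ i) x =
      (∏ j ∈ Finset.range i, k ((orbitPermHom Γ H X a)^[j] (orbitClass Γ x))) • a ^ i • x := by
  induction i with
  | zero => simp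
  | succ i ih =>
    rw [pow_succ', Equiv.Perm.mul_apply, ih, Equiv.Perm.mul_apply, orbitTwist_smul,
      orbitTwist_apply, MulAction.toPerm_apply, smul_comm a, smul_comm a, Finset.prod_range_succ,
      orbitPermHom_iterate_orbitClass, pow_succ', mul_smul, mul_smul]

theorem orbitPermHom_eq_of_mul_orbitTwist_eq {a a' : H}
    {k k' : MulAction.orbitRel.Quotient Γ X → Γ}
    (h : (MulAction.toPerm a : Equiv.Perm X) * orbitTwist k =
      MulAction.toPerm a' * orbitTwist k') :
    orbitPermHom Γ H X a = orbitPermHom Γ H X a' := by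
  ext ⟨x⟩
  have hx : orbitClass Γ (a • k (orbitClass Γ x) • x) =
      orbitClass Γ (a' • k' (orbitClass Γ x) • x) :=
    congrArg (orbitClass Γ) (DFunLike.congr_fun h x)
  rwa [smul_comm a, smul_comm a', orbitClass_smul, orbitClass_smul] at hx

/-- A function `k` from the orbits of `Γ` to `Γ` spreads `z` over the permutation `α` of the orbits
if composing with `orbitTwist k` multiplies by `z` the `n`-th power of each permutation of `X` that
commutes with `Γ` and induces `α`. -/
def IsSpread (n : ℕ) (z : Γ) (α : Equiv.Perm (MulAction.orbitRel.Quotient Γ X))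
    (k : MulAction.orbitRel.Quotient Γ X → Γ) : Prop :=
  ∀ x, (∏ j ∈ Finset.range n, k (α^[j] (orbitClass Γ x))) • x = z • x

theorem IsSpread.pow {n : ℕ} {z : Γ} {α : Equiv.Perm (MulAction.orbitRel.Quotient Γ X)}
    {k : MulAction.orbitRel.Quotient Γ X → Γ} (hk : IsSpread n z α k) (c : ℕ) :
    IsSpread n (z ^ c) α (k ^ c) := fun x => by
  simp only [Pi.pow_apply, Finset.prod_pow]
  exact pow_smul_eq_pow_smul (hk x) c

theorem IsSpread.mul_orbitTwist_pow_apply {n : ℕ} {z z' : Γ} {a : H}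
    {k : MulAction.orbitRel.Quotient Γ X → Γ} (hk : IsSpread n z' (orbitPermHom Γ H X a) k)
    (ha : ∀ x : X, a ^ n • x = z • x) (x : X) :
    (((MulAction.toPerm a : Equiv.Perm X) * orbitTwist k) ^ n) x = (z * z') • x := by
  rw [smul_orbitTwist_pow_apply, ← smul_comm (a ^ n), hk, smul_comm (a ^ n), ha, smul_smul,
    mul_comm]

/-- `k y` is taken to be a power of an element `w y` depending only on the stabilizer of `y`; what
remains is to write the exponent of `z` in terms of `w y` as a Birkhoff sum of the exponents of `k`
for both permutations. -/
theorem exists_common_isSpread [Finite X] {n : ℕ} {z : Γ} {a b : H}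
    (ha : ∀ x : X, a ^ n • x = z • x) (hb : ∀ x : X, b ^ n • x = z • x) :
    ∃ k, IsSpread n z (orbitPermHom Γ H X a) k ∧ IsSpread n z (orbitPermHom Γ H X b) k := by
  rcases eq_or_ne n 0 with rfl | hn
  · exact ⟨1, fun x => by simpa using ha x, fun x => by simpa using hb x⟩
  obtain ⟨w, L, hwL⟩ := exists_pow_smul_eq_and_forall_dvd X hn z
  have hdvd {c : H} (hc : ∀ x : X, c ^ n • x = z • x) (y : MulAction.orbitRel.Quotient Γ X) :
      ((n / Function.minimalPeriod (orbitPermHom Γ H X c) y : ℕ) : ℤ) ∣ L (orbitStabilizer y) := by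
    induction y using Quotient.inductionOn' with | _ x
    refine Int.natCast_dvd_natCast.2 ((hwL x).2 _ (Nat.div_dvd_of_dvd ?_) ?_)
    · exact minimalPeriod_orbitPermHom_dvd hc _
    · exact exists_pow_div_minimalPeriod_smul_eq hc x
  have hinv (c : H) : (fun y => (L (orbitStabilizer y) : ℤ)) ∘ orbitPermHom Γ H X c =
      fun y => (L (orbitStabilizer y) : ℤ) :=
    congrArg (fun S y => (L (S y) : ℤ)) (orbitStabilizer_comp_orbitPermHom c)
  obtain ⟨e, hea, heb⟩ := exists_common_birkhoffSum_eq hn (orbitPermHom_pow_eq_one ha)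
    (orbitPermHom_pow_eq_one hb) (hinv a) (hinv b) (hdvd ha) (hdvd hb)
  have hspread {c : H} (he : birkhoffSum (orbitPermHom Γ H X c) e n =
      fun y => (L (orbitStabilizer y) : ℤ)) :
      IsSpread n z (orbitPermHom Γ H X c) fun y => w (orbitStabilizer y) ^ e y := fun x => by
    have hstab (j : ℕ) :=
      congrFun (Function.iterate_invariant (orbitStabilizer_comp_orbitPermHom (Γ := Γ) c) j)
        (orbitClass Γ x)
    simp only [Function.comp_apply] at hstab
    have hsum : birkhoffSum (orbitPermHom Γ H X c) e n (orbitClass Γ x) =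
        L (MulAction.stabilizer Γ x) := congrFun he _
    simp only [hstab, orbitStabilizer_orbitClass]
    rw [prod_zpow_eq_zpow_sum, ← birkhoffSum, hsum, zpow_natCast]
    exact (hwL x).1
  exact ⟨_, hspread hea, hspread heb⟩

/-- A function spreading `z` over both `α` and `β`, if there is one. Depending only on `α` and `β`,
it can be recovered from twisted permutations. -/
noncomputable def commonSpread (n : ℕ) (z : Γ)
    (α β : Equiv.Perm (MulAction.orbitRel.Quotient Γ X)) : MulAction.orbitRel.Quotient Γ X → Γ :=
  Classical.epsilon fun k => IsSpread n z α k ∧ IsSpread n z β k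

theorem isSpread_commonSpread [Finite X] {n : ℕ} {z : Γ} {a b : H}
    (ha : ∀ x : X, a ^ n • x = z • x) (hb : ∀ x : X, b ^ n • x = z • x) :
    IsSpread n z (orbitPermHom Γ H X a)
        (commonSpread n z (orbitPermHom Γ H X a) (orbitPermHom Γ H X b)) ∧
      IsSpread n z (orbitPermHom Γ H X b)
        (commonSpread n z (orbitPermHom Γ H X a) (orbitPermHom Γ H X b)) :=
  Classical.epsilon_spec (exists_common_isSpread ha hb)

end OrbitTwists

section FSZ

variable {G : Type*} [Group G]

/-- The common `n`-th roots of `z` among `a` and `y * a`; their numbers are the coefficients of the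
`n`-th indicators of the representations of the quantum double. -/
def commonRoots (n : ℕ) (y z : G) : Set G :=
  {a | a ^ n = z ∧ (y * a) ^ n = z}

variable (G) in
/-- FSZ groups, in the sense of Iovanov, Mason and Montgomery: `z` and `z'` have the same number of
common `n`-th roots as soon as they generate the same subgroup. -/
def IsFSZ : Prop :=
  ∀ (n : ℕ) (y z z' : G), Subgroup.zpowers z = Subgroup.zpowers z' →
    Nat.card (commonRoots n y z) = Nat.card (commonRoots n y z')

theorem IsFSZ.of_mulEquiv {G' : Type*} [Group G'] (hG' : IsFSZ G') (e : G ≃* G') : IsFSZ G := by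
  have hcard (n : ℕ) (y z : G) :
      Nat.card (commonRoots n y z) = Nat.card (commonRoots n (e y) (e z)) :=
    Nat.card_congr <| e.toEquiv.subtypeEquiv fun a => by
      simp only [commonRoots, Set.mem_ofPred_eq, MulEquiv.toEquiv_eq_coe, MulEquiv.coe_toEquiv,
        ← map_mul, ← map_pow, e.apply_eq_iff_eq]
  intro n y z z' hz
  rw [hcard, hcard n y z']
  refine hG' n _ _ _ ?_
  have hmap := congrArg (Subgroup.map e.toMonoidHom) hz
  rwa [MonoidHom.map_zpowers, MonoidHom.map_zpowers] at hmap

theorem isFSZ_of_card_commonRoots_le_pow [Finite G]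
    (h : ∀ (n : ℕ) (y z : G) (c : ℕ),
      Nat.card (commonRoots n y z) ≤ Nat.card (commonRoots n y (z * z ^ c))) : IsFSZ G := by
  have hle (n : ℕ) (y : G) {z z' : G} (hz' : z' ∈ Subgroup.zpowers z) :
      Nat.card (commonRoots n y z) ≤ Nat.card (commonRoots n y z') := by
    obtain ⟨c, hc⟩ : z⁻¹ * z' ∈ Submonoid.powers z :=
      mem_powers_iff_mem_zpowers.2 (mul_mem (inv_mem (Subgroup.mem_zpowers z)) hz')
    convert h n y z c
    rw [show z ^ c = z⁻¹ * z' from hc, mul_inv_cancel_left]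
  intro n y z z' hz
  exact (hle n y (hz ▸ Subgroup.mem_zpowers z')).antisymm (hle n y (hz ▸ Subgroup.mem_zpowers z))

end FSZ

section Centralizers

variable {X : Type*} {D : Set (Equiv.Perm X)}

theorem smulCommClass_centralizer (Γ : Subgroup (Equiv.Perm X)) :
    SMulCommClass (Subgroup.centralizer (Γ : Set (Equiv.Perm X))) Γ X where
  smul_comm a c x := (DFunLike.congr_fun (Subgroup.mem_centralizer_iff.1 a.2 c c.2) x).symm

open scoped IsMulCommutative

theorem orbitTwist_mem_centralizer {Γ : Subgroup (Equiv.Perm X)} [IsMulCommutative Γ]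
    (k : MulAction.orbitRel.Quotient Γ X → Γ) :
    orbitTwist k ∈ Subgroup.centralizer (Γ : Set (Equiv.Perm X)) :=
  Subgroup.mem_centralizer_iff.2 fun c hc =>
    Equiv.ext fun x => (orbitTwist_smul k (⟨c, hc⟩ : Γ) x).symm

/-- Each common root `a` is multiplied by an orbit twist that depends only on the permutations of
the orbits induced by `a` and `y * a`. As the product induces the same permutations, it determines
the twist, and hence `a`. -/
theorem card_commonRoots_le_card_commonRoots_mul_pow [Finite X] {Γ : Subgroup (Equiv.Perm X)}
    [IsMulCommutative Γ] (hDΓ : D ⊆ Γ) {z : Subgroup.centralizer D}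
    (hzΓ : (z : Equiv.Perm X) ∈ Γ) (hz : ∀ a : Subgroup.centralizer D, Commute a z →
      (a : Equiv.Perm X) ∈ Subgroup.centralizer (Γ : Set (Equiv.Perm X)))
    (n : ℕ) (y : Subgroup.centralizer D) (c : ℕ) :
    Nat.card (commonRoots n y z) ≤ Nat.card (commonRoots n y (z * z ^ c)) := by
  have := smulCommClass_centralizer Γ
  let H := Subgroup.centralizer (Γ : Set (Equiv.Perm X))
  let ζ : Γ := ⟨z, hzΓ⟩
  let lift (a : Subgroup.centralizer D) (ha : a ^ n = z) : H :=
    ⟨a, hz a (ha ▸ Commute.self_pow a n)⟩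
  have hlift {a : Subgroup.centralizer D} (ha : a ^ n = z) (x : X) : lift a ha ^ n • x = ζ • x :=
    DFunLike.congr_fun (congrArg Subtype.val ha) x
  let k (a : commonRoots n y z) : MulAction.orbitRel.Quotient Γ X → Γ :=
    commonSpread n ζ (orbitPermHom Γ H X (lift a a.2.1)) (orbitPermHom Γ H X (lift (y * a) a.2.2))
  let t (a : commonRoots n y z) : Subgroup.centralizer D :=
    ⟨orbitTwist (k a ^ c), Subgroup.centralizer_le hDΓ (orbitTwist_mem_centralizer _)⟩
  have htwist {b : Subgroup.centralizer D} (hb : b ^ n = z) (a : commonRoots n y z)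
      (hk : IsSpread n ζ (orbitPermHom Γ H X (lift b hb)) (k a)) :
      (b * t a) ^ n = z * z ^ c :=
    Subtype.ext <| Equiv.ext ((hk.pow c).mul_orbitTwist_pow_apply (hlift hb))
  let f (a : commonRoots n y z) : commonRoots n y (z * z ^ c) :=
    ⟨a * t a, htwist a.2.1 a (isSpread_commonSpread (hlift a.2.1) (hlift a.2.2)).1, by
      rw [← mul_assoc]
      exact htwist a.2.2 a (isSpread_commonSpread (hlift a.2.1) (hlift a.2.2)).2⟩
  refine Nat.card_le_card_of_injective f fun a a' h => Subtype.ext ?_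
  have hmul : (a : Subgroup.centralizer D) * t a = a' * t a' := congrArg Subtype.val h
  have hmul' : y * a * t a = y * a' * t a' := by rw [mul_assoc, hmul, mul_assoc]
  have ht : t a = t a' := by
    have h₁ := orbitPermHom_eq_of_mul_orbitTwist_eq (a := lift a a.2.1) (a' := lift a' a'.2.1)
      (congrArg Subtype.val hmul)
    have h₂ := orbitPermHom_eq_of_mul_orbitTwist_eq (a := lift (y * a) a.2.2)
      (a' := lift (y * a') a'.2.2) (congrArg Subtype.val hmul')
    simp only [t, k, h₁, h₂]
  rwa [ht, mul_left_inj] at hmul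

theorem isFSZ_centralizer [Finite X] (hD : ∀ c ∈ D, ∀ d ∈ D, c * d = d * c) :
    IsFSZ (Subgroup.centralizer D) := by
  refine isFSZ_of_card_commonRoots_le_pow fun n y z c => ?_
  have hzD := Subgroup.mem_centralizer_iff.1 z.2
  have hcomm : ∀ c ∈ insert (z : Equiv.Perm X) D, ∀ d ∈ insert (z : Equiv.Perm X) D,
      c * d = d * c := by
    rintro c (rfl | hc) d (rfl | hd)
    exacts [rfl, (hzD d hd).symm, hzD c hc, hD c hc d hd]
  have := Subgroup.isMulCommutative_closure hcomm
  refine card_commonRoots_le_card_commonRoots_mul_pow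
    ((Set.subset_insert _ D).trans Subgroup.subset_closure)
    (Subgroup.subset_closure (Set.mem_insert _ D)) (fun a ha => ?_) n y c
  rw [Subgroup.centralizer_closure, Subgroup.mem_centralizer_iff]
  rintro d (rfl | hd)
  exacts [congrArg Subtype.val ha.symm.eq, Subgroup.mem_centralizer_iff.1 a.2 d hd]

end Centralizers

namespace WreathProduct

variable {A : Type*} [CommGroup A] {N : ℕ}

/-- The imprimitive action of the wreath product on `N` copies of `A`. -/
def toPermHom : WreathProduct A N →* Equiv.Perm (Fin N × A) :=
  MonoidHom.toHomPerm
    { toFun := fun g p => (g.right p.1, g.left (g.right p.1) * p.2)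
      map_one' := funext fun p => Prod.ext rfl (one_mul p.2)
      map_mul' := fun g h => by
        have hcoord (i : Fin N) : mulAutArrow g.right h.left (g.right i) = h.left i :=
          congrArg h.left (g.right.symm_apply_apply i)
        refine funext fun p => Prod.ext rfl ?_
        simp only [SemidirectProduct.mul_left, SemidirectProduct.mul_right, Pi.mul_apply,
          Equiv.Perm.mul_apply, hcoord, mul_assoc]
        rfl }

theorem toPermHom_apply (g : WreathProduct A N) (p : Fin N × A) :
    toPermHom g p = (g.right p.1, g.left (g.right p.1) * p.2) := rfl

theorem toPermHom_injective : Function.Injective (toPermHom (A := A) (N := N)) := by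
  intro g h hgh
  have hp (i : Fin N) : g.right i = h.right i ∧ g.left (g.right i) * 1 = h.left (h.right i) * 1 :=
    Prod.ext_iff.1 (DFunLike.congr_fun hgh (i, 1))
  have hright : g.right = h.right := Equiv.ext fun i => (hp i).1
  refine SemidirectProduct.ext (funext fun i => ?_) hright
  have hleft := (hp (g.right.symm i)).2
  rwa [← hright, mul_one, mul_one, Equiv.apply_symm_apply] at hleft

/-- Translation by `c` in each of the `N` copies of `A`. -/
def translation (N : ℕ) (c : A) : Equiv.Perm (Fin N × A) :=
  Equiv.prodCongr (Equiv.refl (Fin N)) (Equiv.mulLeft c)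

theorem translation_mul_comm (c d : A) :
    translation N c * translation N d = translation N d * translation N c := by
  ext p <;> simp [translation, mul_left_comm]

theorem range_toPermHom : (toPermHom (A := A) (N := N)).range =
    Subgroup.centralizer (Set.range (translation N)) := by
  ext p
  rw [Subgroup.mem_centralizer_iff]
  refine ⟨?_, fun hp => ?_⟩
  · rintro ⟨g, rfl⟩ _ ⟨c, rfl⟩
    ext q <;> simp [toPermHom_apply, translation, mul_left_comm]
  · have hp_apply (i : Fin N) (x : A) : p (i, x) = ((p (i, 1)).1, x * (p (i, 1)).2) := by
      have h := DFunLike.congr_fun (hp _ ⟨x, rfl⟩) (i, 1)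
      simpa [translation, Prod.map_def] using h.symm
    have hsurj : Function.Surjective fun i => (p (i, 1)).1 := fun i => by
      obtain ⟨⟨i', x⟩, h⟩ := p.surjective (i, 1)
      exact ⟨i', by simpa [hp_apply i' x] using congrArg Prod.fst h⟩
    let σ : Equiv.Perm (Fin N) :=
      Equiv.ofBijective (fun i => (p (i, 1)).1) (Finite.surjective_iff_bijective.1 hsurj)
    refine ⟨⟨fun i => (p (σ.symm i, 1)).2, σ⟩, Equiv.ext fun ⟨i, x⟩ => ?_⟩
    rw [toPermHom_apply, hp_apply i x]
    simp only [Equiv.symm_apply_apply, mul_comm x]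
    rfl

variable (A N) in
/-- The wreath product as the group of permutations of `N` copies of `A` that commute with the
translations. -/
noncomputable def mulEquivCentralizer :
    WreathProduct A N ≃* Subgroup.centralizer (Set.range (translation (A := A) N)) :=
  (MonoidHom.ofInjective toPermHom_injective).trans (MulEquiv.subgroupCongr range_toPermHom)

end WreathProduct

section SweedlerPowers

variable (k : Type*) [CommRing k] {H : Type*} [Ring H] [HopfAlgebra k H]

/-- The Sweedler power `h ↦ h₁ ⋯ hₙ`, whose trace at an integral is the `n`-th indicator. -/
noncomputable def sweedlerPower (n : ℕ) : H →ₗ[k] H :=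
  iteratedMul k n ∘ₗ iteratedComul k n

theorem sweedlerPower_zero (h : H) :
    sweedlerPower k 0 h = Coalgebra.counit (R := k) h • (1 : H) := by
  simp [sweedlerPower, iteratedComul, iteratedMul, TensorPower.algebraMap₀_eq_smul_one,
    TensorPower.gOne_def]

theorem iteratedMul_mulEquiv_tmul (n : ℕ) (x : ⨂[k]^n H) (h : H) :
    iteratedMul k (n + 1) (TensorPower.mulEquiv (R := k) (M := H) (n := n) (m := 1) (x ⊗ₜ[k]
      (PiTensorProduct.subsingletonEquiv (R := k) (s := fun _ : Fin 1 => H) 0).symm h)) =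
      iteratedMul k n x * h := by
  induction x using PiTensorProduct.induction_on with
  | add x y hx hy => rw [TensorProduct.add_tmul, map_add, map_add, hx, hy, map_add, add_mul]
  | smul_tprod r f =>
    have htprod : (PiTensorProduct.subsingletonEquiv (R := k) (s := fun _ : Fin 1 => H) 0).symm h =
        PiTensorProduct.tprod k (fun _ : Fin 1 => h) :=
      PiTensorProduct.subsingletonEquiv_symm_apply' (R := k) (0 : Fin 1) h
    have hmul := TensorPower.tprod_mul_tprod k f (fun _ : Fin 1 => h)
    rw [TensorPower.gMul_def] at hmul
    rw [htprod, ← TensorProduct.smul_tmul', map_smul, map_smul, hmul]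
    simp [iteratedMul, List.ofFn_fin_append, -List.ofFn_succ]

theorem sweedlerPower_succ (n : ℕ) (h : H) :
    sweedlerPower k (n + 1) h = LinearMap.mul' k H
      (TensorProduct.map (sweedlerPower k n) LinearMap.id (Coalgebra.comul (R := k) h)) := by
  simp only [sweedlerPower, iteratedComul, LinearMap.comp_apply]
  induction Coalgebra.comul (R := k) h using TensorProduct.induction_on with
  | zero => simp only [map_zero]
  | add x y hx hy => simp only [map_add, hx, hy]
  | tmul x y =>
    simp only [TensorProduct.map_tmul, LinearEquiv.coe_coe, iteratedMul_mulEquiv_tmul,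
      LinearMap.mul'_apply, LinearMap.comp_apply, LinearMap.id_apply]

end SweedlerPowers

section ListProducts

theorem prod_ofFn_snoc {α M : Type*} [Monoid M] {n : ℕ} (f : α → M) (u : Fin n → α) (w : α) :
    (List.ofFn fun i => f (Fin.snoc (α := fun _ => α) u w i)).prod =
      (List.ofFn fun i => f (u i)).prod * f w := by
  simp [List.ofFn_succ', -List.ofFn_succ]

variable {G : Type*} [Group G]

theorem prod_ofFn_conj {n : ℕ} (h : G) (v : Fin n → G) :
    (List.ofFn fun i => h * v i * h⁻¹).prod = h * (List.ofFn v).prod * h⁻¹ := by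
  have hconj := map_list_prod (MulAut.conj h) (List.ofFn v)
  rw [List.map_ofFn] at hconj
  exact hconj.symm

theorem prod_ofFn_comp_finRotate_eq_one_iff {m : ℕ} (u : Fin (m + 1) → G) :
    (List.ofFn (u ∘ finRotate (m + 1))).prod = 1 ↔ (List.ofFn u).prod = 1 := by
  obtain ⟨⟨w, v⟩, rfl⟩ := (Fin.consEquiv fun _ : Fin (m + 1) => G).surjective u
  have hsnoc : (Fin.consEquiv fun _ : Fin (m + 1) => G) (w, v) ∘ finRotate (m + 1) =
      fun i => Fin.snoc (α := fun _ => G) v w i := (Fin.snoc_eq_cons_rotate v w).symm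
  rw [hsnoc, prod_ofFn_snoc fun x : G => x, mul_eq_one_comm, List.ofFn_succ, List.prod_cons]
  rfl

end ListProducts

namespace QuantumDouble

variable {k G : Type*} [CommRing k] [Group G] [Fintype G]

theorem sweedlerPower_succ_gδ (n : ℕ) (g x : G) :
    sweedlerPower k (n + 1) (gδ k g x) =
      ∑ u : G, sweedlerPower k n (gδ k g u) * gδ k g (u⁻¹ * x) := by
  simp [sweedlerPower_succ, comul_gδ]

open Classical in
theorem sweedlerPower_gδ (n : ℕ) (g x : G) :
    sweedlerPower k n (gδ k g x) =
      ∑ y : G, if g ^ n * (g⁻¹ * y) ^ n = x then gδ k (g ^ n) y else 0 := by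
  induction n generalizing x with
  | zero =>
    rw [sweedlerPower_zero, counit_gδ, one_def]
    simp [eq_comm (a := x)]
  | succ n ih =>
    rw [sweedlerPower_succ_gδ]
    simp only [ih, Finset.sum_mul, ite_mul, zero_mul]
    rw [Finset.sum_comm]
    simp only [Finset.sum_ite_eq, Finset.mem_univ, if_true, gδ_mul_gδ]
    refine Fintype.sum_equiv (MulAut.conj g⁻¹).toEquiv _ _ fun y => ?_
    have hconj : (MulAut.conj g⁻¹).toEquiv y = g⁻¹ * y * g := by simp
    have hpow : g ^ (n + 1) * (g⁻¹ * (g⁻¹ * y * g)) ^ (n + 1) =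
        g ^ n * (g⁻¹ * y) ^ n * (g⁻¹ * y * g) := by
      rw [show g⁻¹ * (g⁻¹ * y * g) = g⁻¹ * (g⁻¹ * y) * g⁻¹⁻¹ by group, conj_pow, pow_succ, pow_succ]
      group
    rw [hconj, hpow, ← pow_succ]
    by_cases h : g⁻¹ * y * g = (g ^ n * (g⁻¹ * y) ^ n)⁻¹ * x
    · rw [if_pos h, if_pos (eq_inv_mul_iff_mul_eq.1 h), h]
    · rw [if_neg h, if_neg (mt eq_inv_mul_iff_mul_eq.2 h)]

open Classical in
theorem sweedlerPower_gδ_eq_sum_prod_ofFn (n : ℕ) (g x : G) :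
    sweedlerPower k n (gδ k g x) =
      ∑ u : Fin n → G, if (List.ofFn u).prod = x then
        (List.ofFn fun i => gδ k g (u i)).prod else 0 := by
  induction n generalizing x with
  | zero =>
    rw [sweedlerPower_zero, counit_gδ]
    simp [eq_comm (a := x)]
  | succ n ih =>
    rw [sweedlerPower_succ_gδ]
    simp only [ih, Finset.sum_mul, ite_mul, zero_mul]
    rw [Finset.sum_comm, ← (Fin.snocEquiv fun _ : Fin (n + 1) => G).sum_comp,
      Fintype.sum_prod_type, Finset.sum_comm (s := (Finset.univ : Finset G))]
    refine Finset.sum_congr rfl fun u _ => ?_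
    have hprod (w : G) : (List.ofFn (Fin.snocEquiv (fun _ : Fin (n + 1) => G) (w, u))).prod =
        (List.ofFn u).prod * w := prod_ofFn_snoc (fun x : G => x) u w
    have hprod' (w : G) : (List.ofFn fun i =>
        gδ k g (Fin.snocEquiv (fun _ : Fin (n + 1) => G) (w, u) i)).prod =
        (List.ofFn fun i => gδ k g (u i)).prod * gδ k g w := prod_ofFn_snoc (gδ k g) u w
    simp only [hprod, hprod', ← eq_inv_mul_iff_mul_eq, Finset.sum_ite_eq', Finset.sum_ite_eq,
      Finset.mem_univ, if_true]

theorem sum_sweedlerPower_gδ_one (n : ℕ) :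
    ∑ g : G, sweedlerPower k n (gδ k g 1) =
      ∑ y : G, ∑ z : G, Nat.card (commonRoots n y⁻¹ z) • gδ k z y := by
  classical
  simp only [sweedlerPower_gδ]
  rw [Finset.sum_comm]
  refine Finset.sum_congr rfl fun y _ => ?_
  rw [← Finset.sum_fiberwise _ fun g : G => g ^ n]
  refine Finset.sum_congr rfl fun z _ => ?_
  have hcond (g : G) : g ^ n * (g⁻¹ * y) ^ n = 1 ↔ (y⁻¹ * g) ^ n = g ^ n := by
    rw [mul_eq_one_iff_inv_eq, ← inv_inj, inv_inv, ← inv_pow, mul_inv_rev, inv_inv, eq_comm]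
  have hcard : Nat.card (commonRoots n y⁻¹ z) =
      ({g | g ^ n = z ∧ (y⁻¹ * g) ^ n = z} : Finset G).card :=
    Nat.subtype_card _ fun g => by simp [commonRoots]
  rw [hcard, ← Finset.sum_const, ← Finset.sum_filter, Finset.filter_filter]
  refine Finset.sum_congr (Finset.filter_congr fun g _ => and_congr_right ?_) fun g hg => ?_
  · rintro rfl
    exact hcond g
  · rw [(Finset.mem_filter.1 hg).2.1]

theorem sum_gδ_one_mul (a : QuantumDouble k G) :
    (∑ g : G, gδ k g 1) * a = Coalgebra.counit (R := k) a • ∑ g : G, gδ k g 1 := by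
  classical
  induction a using induction_on with
  | zero => simp
  | add a b ha hb => simp only [map_add, mul_add, add_smul, ha, hb]
  | smul r a ha => simp only [map_smul, mul_smul_comm, smul_assoc, ha]
  | basis g x =>
    simp only [Finset.sum_mul, counit_gδ, gδ_mul_gδ, mul_one, inv_mul_cancel]
    by_cases hx : x = 1
    · simpa [hx] using Equiv.sum_comp (Equiv.mulRight g) fun h => gδ k h 1
    · simp [hx, Ne.symm hx]

/-- Both sides are the product of the right integral `∑ g, gδ k g 1` and the left integral `Λ`. -/
theorem card_smul_of_isLeftIntegral {Λ : QuantumDouble k G} (hΛ : IsLeftIntegral k Λ)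
    (hΛ₁ : Coalgebra.counit (R := k) Λ = 1) :
    (Fintype.card G : k) • Λ = ∑ g : G, gδ k g 1 := by
  have h := sum_gδ_one_mul Λ
  rw [hΛ, hΛ₁, one_smul] at h
  simpa [counit_gδ] using h

variable {Λ : QuantumDouble k G} (V : Type*) [AddCommGroup V] [Module k V]
  [Module (QuantumDouble k G) V] [IsScalarTower k (QuantumDouble k G) V]

theorem card_mul_frobeniusSchurIndicator (hΛ : IsLeftIntegral k Λ)
    (hΛ₁ : Coalgebra.counit (R := k) Λ = 1) (n : ℕ) :
    (Fintype.card G : k) * frobeniusSchurIndicator k Λ V n =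
      LinearMap.trace k V (Algebra.lsmul k k V (∑ g : G, sweedlerPower k n (gδ k g 1))) := by
  rw [← map_sum, ← card_smul_of_isLeftIntegral hΛ hΛ₁]
  simp only [map_smul, smul_eq_mul]
  rfl

theorem card_mul_frobeniusSchurIndicator_eq_sum_commonRoots (hΛ : IsLeftIntegral k Λ)
    (hΛ₁ : Coalgebra.counit (R := k) Λ = 1) (n : ℕ) :
    (Fintype.card G : k) * frobeniusSchurIndicator k Λ V n =
      ∑ y : G, ∑ z : G, Nat.card (commonRoots n y⁻¹ z) •
        LinearMap.trace k V (Algebra.lsmul k k V (gδ k z y)) := by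
  rw [card_mul_frobeniusSchurIndicator V hΛ hΛ₁, sum_sweedlerPower_gδ_one]
  simp only [map_sum, map_nsmul]

end QuantumDouble

section IntegralTraces

variable {ι : Type*} [Fintype ι] [DecidableEq ι] {K : Type*} [Field K]

theorem isIntegral_matrix_trace {R : Type*} [CommRing R] [Algebra R K] {M : Matrix ι ι K}
    (hM : IsIntegral R M) : IsIntegral R M.trace := by
  let L := AlgebraicClosure K
  have hML : IsIntegral R (M.map (algebraMap K L)) :=
    hM.map (IsScalarTower.toAlgHom R K L).mapMatrix
  rw [← isIntegral_algebraMap_iff (algebraMap K L).injective, AddMonoidHom.map_trace,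
    Matrix.trace_eq_sum_roots_charpoly]
  refine IsIntegral.multiset_sum fun r hr => ?_
  obtain ⟨p, hp, hpM⟩ := hML
  refine ⟨p, hp, ?_⟩
  rw [← Polynomial.aeval_def, ← Polynomial.aeval_map_algebraMap L] at hpM ⊢
  have hr' := Matrix.mem_spectrum_of_isRoot_charpoly (Polynomial.isRoot_of_mem_roots hr)
  have : Nontrivial (Matrix ι ι L) := not_subsingleton_iff_nontrivial.1 fun _ => by
    rwa [spectrum.of_subsingleton] at hr'
  have hpr := spectrum.subset_polynomial_aeval _ (p.map (algebraMap R L)) ⟨r, hr', rfl⟩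
  rwa [hpM, spectrum.zero_eq] at hpr

theorem isIntegral_trace_mul_of_isIdempotentElem {P C : Matrix ι ι K} (hP : IsIdempotentElem P)
    (hC : IsOfFinOrder C) (hPC : Commute P C) : IsIntegral ℤ (P * C).trace := by
  obtain ⟨j, hj, hCj⟩ := isOfFinOrder_iff_pow_eq_one.1 hC
  have hPint : IsIntegral ℤ P :=
    ⟨Polynomial.X ^ 2 - Polynomial.X, Polynomial.monic_X_pow_sub (by simp),
      by simp [sq, hP.eq]⟩
  refine isIntegral_matrix_trace (IsIntegral.of_pow hj ?_)
  rw [hPC.mul_pow, hCj, mul_one]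
  exact hPint.pow j

theorem isIdempotentElem_inv_card_smul_sum {G A : Type*} [Group G] [Fintype G] [CharZero K]
    [Semiring A] [Algebra K A] (M : G →ₙ* A) :
    IsIdempotentElem ((Fintype.card G : K)⁻¹ • ∑ g : G, M g) := by
  have hsum (g : G) : ∑ h : G, M (g * h) = ∑ h : G, M h := Equiv.sum_comp (Equiv.mulLeft g) M
  have hcard : (Fintype.card G : K) ≠ 0 := Nat.cast_ne_zero.2 Fintype.card_ne_zero
  rw [IsIdempotentElem, smul_mul_smul_comm, Finset.sum_mul_sum]
  simp only [← map_mul, hsum, Finset.sum_const, Finset.card_univ]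
  rw [← Nat.cast_smul_eq_nsmul K, smul_smul, inv_mul_cancel_right₀ hcard]

theorem isIntegral_inv_card_mul_sum_trace_mul {G : Type*} [Group G] [Fintype G] [CharZero K]
    (M : G →ₙ* Matrix ι ι K) {C : Matrix ι ι K} (hC : IsOfFinOrder C)
    (hMC : ∀ g, Commute (M g) C) :
    IsIntegral ℤ ((Fintype.card G : K)⁻¹ * ∑ g : G, (M g * C).trace) := by
  have h := isIntegral_trace_mul_of_isIdempotentElem
    (isIdempotentElem_inv_card_smul_sum (K := K) M) hC
    ((Commute.sum_left _ _ _ fun g _ => hMC g).smul_left _)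
  simpa [Finset.sum_mul, Matrix.trace_sum] using h

end IntegralTraces

section CyclicTraces

variable {ι R : Type*} [CommRing R]

/-- The matrix of the tensor product of a finite family of endomorphisms. -/
def kroneckerPi {n : ℕ} (M : Fin n → Matrix ι ι R) : Matrix (Fin n → ι) (Fin n → ι) R :=
  Matrix.of fun a b => ∏ i, M i (a i) (b i)

theorem kroneckerPi_eq_zero {n : ℕ} {M : Fin n → Matrix ι ι R} {i : Fin n} (h : M i = 0) :
    kroneckerPi M = 0 := by
  ext a b
  exact Finset.prod_eq_zero (Finset.mem_univ i) (by simp [h])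

variable [Fintype ι]

theorem kroneckerPi_mul {n : ℕ} (M M' : Fin n → Matrix ι ι R) :
    kroneckerPi M * kroneckerPi M' = kroneckerPi fun i => M i * M' i := by
  ext a c
  simp only [kroneckerPi, Matrix.mul_apply, Matrix.of_apply, Finset.prod_univ_sum,
    Fintype.piFinset_univ, Finset.prod_mul_distrib]

variable [DecidableEq ι]

theorem list_prod_ofFn_apply_eq_sum {m : ℕ} (M : Fin (m + 1) → Matrix ι ι R) (x y : ι) :
    (List.ofFn M).prod x y = ∑ a : Fin m → ι, ∏ i : Fin (m + 1),
      M i (Fin.cons (α := fun _ => ι) x a i) (Fin.snoc (α := fun _ => ι) a y i) := by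
  induction m generalizing x with
  | zero => simp [Fin.snoc]
  | succ m ih =>
    rw [List.ofFn_succ, List.prod_cons, Matrix.mul_apply]
    simp only [ih, Finset.mul_sum]
    rw [← (Fin.consEquiv fun _ : Fin (m + 1) => ι).sum_comp, Fintype.sum_prod_type]
    refine Finset.sum_congr rfl fun w _ => Finset.sum_congr rfl fun a _ => ?_
    rw [show (Fin.consEquiv fun _ : Fin (m + 1) => ι) (w, a) = Fin.cons w a from rfl,
      ← Fin.cons_snoc_eq_snoc_cons]
    exact Eq.symm <| Fin.prod_univ_succ _

variable (ι R) in
/-- The matrix of the cyclic rotation of the factors of the `n`-th tensor power. -/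
def rotationMatrix (n : ℕ) : Matrix (Fin n → ι) (Fin n → ι) R :=
  Matrix.permMatrixHom (Equiv.arrowCongr (finRotate n).symm (Equiv.refl ι))

theorem isOfFinOrder_rotationMatrix (n : ℕ) : IsOfFinOrder (rotationMatrix ι R n) :=
  MonoidHom.isOfFinOrder _ (isOfFinOrder_of_finite _)

theorem mul_rotationMatrix_apply {n : ℕ} (M : Matrix (Fin n → ι) (Fin n → ι) R) (a b : Fin n → ι) :
    (M * rotationMatrix ι R n) a b = M a (b ∘ finRotate n) :=
  congrFun₂ (PEquiv.mul_toMatrix_toPEquiv M _) a b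

theorem rotationMatrix_mul_apply {n : ℕ} (M : Matrix (Fin n → ι) (Fin n → ι) R) (a b : Fin n → ι) :
    (rotationMatrix ι R n * M) a b = M (a ∘ (finRotate n).symm) b :=
  congrFun₂ (PEquiv.toMatrix_toPEquiv_mul _ M) a b

theorem kroneckerPi_comp_finRotate_mul_rotationMatrix {n : ℕ} (M : Fin n → Matrix ι ι R) :
    kroneckerPi (M ∘ finRotate n) * rotationMatrix ι R n =
      rotationMatrix ι R n * kroneckerPi M := by
  ext a b
  rw [mul_rotationMatrix_apply, rotationMatrix_mul_apply]
  have h := Equiv.prod_comp (finRotate n) fun i => M i (a ((finRotate n).symm i)) (b i)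
  simp only [Equiv.symm_apply_apply] at h
  exact h

theorem trace_kroneckerPi_mul_rotationMatrix {m : ℕ} (M : Fin (m + 1) → Matrix ι ι R) :
    (kroneckerPi M * rotationMatrix ι R (m + 1)).trace = (List.ofFn M).prod.trace := by
  simp only [Matrix.trace, Matrix.diag, list_prod_ofFn_apply_eq_sum, mul_rotationMatrix_apply]
  rw [← (Fin.consEquiv fun _ : Fin (m + 1) => ι).sum_comp, Fintype.sum_prod_type]
  refine Finset.sum_congr rfl fun w _ => Finset.sum_congr rfl fun a _ => ?_
  rw [Fin.snoc_eq_cons_rotate]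
  rfl

end CyclicTraces

namespace QuantumDouble

section TensorPowers

variable {k G : Type*} [CommRing k] [Group G] [Fintype G] {ι : Type*} [Fintype ι] [DecidableEq ι]
  (ρ : QuantumDouble k G →ₐ[k] Matrix ι ι k)

open Classical in
/-- The action of `Δₙ (g δ₁)` on the `n`-th tensor power of a matrix representation. -/
noncomputable def tensorPowerMatrix (n : ℕ) (g : G) : Matrix (Fin n → ι) (Fin n → ι) k :=
  ∑ u : Fin n → G with (List.ofFn u).prod = 1, kroneckerPi fun i => ρ (gδ k g (u i))

theorem tensorPowerMatrix_mul (n : ℕ) (g h : G) :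
    tensorPowerMatrix ρ n (g * h) = tensorPowerMatrix ρ n g * tensorPowerMatrix ρ n h := by
  classical
  simp only [tensorPowerMatrix, Finset.sum_mul_sum, kroneckerPi_mul, ← map_mul, gδ_mul_gδ]
  rw [Finset.sum_comm]
  refine Finset.sum_congr rfl fun v hv => ?_
  have hconj (u x : G) : h⁻¹ * u * h = x ↔ u = h * x * h⁻¹ := by
    rw [mul_assoc, inv_mul_eq_iff_eq_mul, ← eq_mul_inv_iff_mul_eq]
  simp only [hconj]
  rw [Finset.sum_eq_single_of_mem fun i => h * v i * h⁻¹]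
  · simp only [if_true]
  · rw [Finset.mem_filter] at hv ⊢
    exact ⟨Finset.mem_univ _, by rw [prod_ofFn_conj, conj_eq_one_iff, hv.2]⟩
  · intro u _ hu
    obtain ⟨i, hi⟩ := Function.ne_iff.1 hu
    exact kroneckerPi_eq_zero (i := i) (by rw [if_neg hi, map_zero])

theorem commute_tensorPowerMatrix_rotationMatrix (m : ℕ) (g : G) :
    Commute (tensorPowerMatrix ρ (m + 1) g) (rotationMatrix ι k (m + 1)) := by
  classical
  rw [Commute, SemiconjBy, tensorPowerMatrix, Finset.sum_mul, Finset.mul_sum]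
  refine (Finset.sum_equiv (Equiv.arrowCongr (finRotate (m + 1)).symm (Equiv.refl G))
    (fun u => ?_) fun u _ => ?_).symm
  · simp only [Finset.mem_filter_univ]
    exact (prod_ofFn_comp_finRotate_eq_one_iff u).symm
  · exact (kroneckerPi_comp_finRotate_mul_rotationMatrix fun i => ρ (gδ k g (u i))).symm

theorem trace_tensorPowerMatrix_mul_rotationMatrix (m : ℕ) (g : G) :
    (tensorPowerMatrix ρ (m + 1) g * rotationMatrix ι k (m + 1)).trace =
      (ρ (sweedlerPower k (m + 1) (gδ k g 1))).trace := by
  classical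
  rw [sweedlerPower_gδ_eq_sum_prod_ofFn, ← Finset.sum_filter, tensorPowerMatrix, Finset.sum_mul]
  simp only [map_sum, Matrix.trace_sum, trace_kroneckerPi_mul_rotationMatrix, map_list_prod,
    List.map_ofFn]
  rfl

end TensorPowers

theorem isIntegral_frobeniusSchurIndicator {k G : Type*} [Field k] [CharZero k] [Group G]
    [Fintype G] {Λ : QuantumDouble k G} (hΛ : IsLeftIntegral k Λ)
    (hΛ₁ : Coalgebra.counit (R := k) Λ = 1) (V : Type*) [AddCommGroup V] [Module k V]
    [FiniteDimensional k V] [Module (QuantumDouble k G) V] [IsScalarTower k (QuantumDouble k G) V]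
    (n : ℕ) : IsIntegral ℤ (frobeniusSchurIndicator k Λ V n) := by
  cases n with
  | zero =>
    have h : frobeniusSchurIndicator k Λ V 0 = Module.finrank k V := by
      change LinearMap.trace k V (Algebra.lsmul k k V (sweedlerPower k 0 Λ)) = _
      rw [sweedlerPower_zero, hΛ₁, one_smul, map_one, LinearMap.trace_one]
    exact h ▸ isIntegral_natCast _
  | succ m =>
    let b := Module.finBasis k V
    let ρ : QuantumDouble k G →ₐ[k] Matrix _ _ k :=
      (LinearMap.toMatrixAlgEquiv b).toAlgHom.comp (Algebra.lsmul k k V)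
    have hcard : (Fintype.card G : k) ≠ 0 := Nat.cast_ne_zero.2 Fintype.card_ne_zero
    have hsum : frobeniusSchurIndicator k Λ V (m + 1) = (Fintype.card G : k)⁻¹ *
        ∑ g : G, (tensorPowerMatrix ρ (m + 1) g * rotationMatrix _ k (m + 1)).trace := by
      rw [eq_inv_mul_iff_mul_eq₀ hcard, card_mul_frobeniusSchurIndicator V hΛ hΛ₁,
        LinearMap.trace_eq_matrix_trace k b]
      simp only [trace_tensorPowerMatrix_mul_rotationMatrix, ← Matrix.trace_sum, ← map_sum]
      rfl
    rw [hsum]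
    exact isIntegral_inv_card_mul_sum_trace_mul
      ⟨tensorPowerMatrix ρ (m + 1), tensorPowerMatrix_mul ρ (m + 1)⟩
      (isOfFinOrder_rotationMatrix (m + 1)) (commute_tensorPowerMatrix_rotationMatrix ρ m)

end QuantumDouble

section CyclicSums

variable {G M σ : Type*} [Group G] [Fintype G] [AddCommGroup M] [SetLike σ M]
  [AddSubgroupClass σ M] {S : σ} {t : G → M}

open Classical in
theorem sum_zpowers_eq_mem (ht : ∀ C : Subgroup G, ∑ g : C, t g ∈ S) (C : Subgroup G) :
    ∑ g : G with Subgroup.zpowers g = C, t g ∈ S := by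
  induction C using WellFoundedLT.induction with
  | ind C ih =>
    have := Fintype.ofFinite (Subgroup G)
    have hsum : ∑ g : C, t g =
        ∑ C' : Subgroup G with C' ≤ C, ∑ g : G with Subgroup.zpowers g = C', t g := by
      rw [← Finset.sum_subtype {g | g ∈ C} (fun g => Finset.mem_filter_univ g),
        ← Finset.sum_fiberwise_of_maps_to (g := Subgroup.zpowers) (t := {C' | C' ≤ C})]
      · refine Finset.sum_congr rfl fun C' hC' => Finset.sum_congr ?_ fun _ _ => rfl
        rw [Finset.mem_filter_univ] at hC'
        ext g
        simp only [Finset.mem_filter, Finset.mem_univ, true_and, and_iff_right_iff_imp]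
        rintro rfl
        exact hC' (Subgroup.mem_zpowers g)
      · simp
    have hC : C ∈ ({C' | C' ≤ C} : Finset (Subgroup G)) := (Finset.mem_filter_univ C).2 le_rfl
    rw [← Finset.add_sum_erase _ _ hC] at hsum
    rw [← add_mem_cancel_right (sum_mem fun C' hC' => ih C' ?_), ← hsum]
    · exact ht C
    · obtain ⟨hne, hle⟩ := Finset.mem_erase.1 hC'
      exact lt_of_le_of_ne ((Finset.mem_filter_univ C').1 hle) hne

open Classical in
theorem sum_nsmul_mem_of_sum_subgroup_mem (ht : ∀ C : Subgroup G, ∑ g : C, t g ∈ S) {c : G → ℕ}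
    (hc : ∀ g g', Subgroup.zpowers g = Subgroup.zpowers g' → c g = c g') :
    ∑ g, c g • t g ∈ S := by
  rw [← Finset.sum_fiberwise_of_maps_to (g := Subgroup.zpowers) (t := Finset.univ.image _)
    fun g _ => Finset.mem_image_of_mem _ (Finset.mem_univ g)]
  refine sum_mem fun C hC => ?_
  obtain ⟨g₀, -, rfl⟩ := Finset.mem_image.1 hC
  rw [Finset.sum_congr rfl fun g hg => by rw [hc g g₀ (Finset.mem_filter.1 hg).2],
    ← Finset.smul_sum]
  exact nsmul_mem (sum_zpowers_eq_mem ht _) _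

end CyclicSums

section RationalTraces

variable {k : Type*} [Field k] [CharZero k]

theorem trace_mem_fieldRange_of_mul_self_eq_nsmul {V : Type*} [AddCommGroup V] [Module k V]
    [FiniteDimensional k V] {f : Module.End k V} {m : ℕ} (hm : m ≠ 0) (hf : f * f = m • f) :
    LinearMap.trace k V f ∈ (algebraMap ℚ k).fieldRange := by
  have hm' : (m : k) ≠ 0 := Nat.cast_ne_zero.2 hm
  have hidem : IsIdempotentElem ((m : k)⁻¹ • f) := by
    rw [IsIdempotentElem, smul_mul_smul_comm, hf, ← Nat.cast_smul_eq_nsmul k, smul_smul,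
      inv_mul_cancel_right₀ hm']
  have htrace := (LinearMap.IsIdempotentElem.isProj_range _ hidem).trace
  rw [map_smul, smul_eq_mul, inv_mul_eq_iff_eq_mul₀ hm'] at htrace
  rw [htrace]
  exact mul_mem (natCast_mem _ _) (natCast_mem _ _)

theorem exists_int_of_isIntegral_of_mem_fieldRange {x : k} (hx : IsIntegral ℤ x)
    (hq : x ∈ (algebraMap ℚ k).fieldRange) : ∃ m : ℤ, x = m := by
  obtain ⟨q, rfl⟩ := hq
  obtain ⟨m, rfl⟩ := IsIntegrallyClosed.isIntegral_iff.1
    ((isIntegral_algebraMap_iff (algebraMap ℚ k).injective).1 hx)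
  exact ⟨m, by simp⟩

end RationalTraces

namespace QuantumDouble

theorem exists_sum_gδ_mul_self {k G : Type*} [CommRing k] [Group G] [Fintype G] (y : G)
    (C : Subgroup G) [Fintype C] : ∃ m : ℕ, m ≠ 0 ∧
      (∑ z : C, gδ k (z : G) y) * ∑ z : C, gδ k (z : G) y = m • ∑ z : C, gδ k (z : G) y := by
  classical
  have hsum (w : C) : ∑ z : C, gδ k (z * w : G) y = ∑ z : C, gδ k (z : G) y :=
    Equiv.sum_comp (Equiv.mulRight w) fun z : C => gδ k (z : G) y
  refine ⟨({w | (w : G)⁻¹ * y * w = y} : Finset C).card,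
    Finset.card_ne_zero_of_mem (a := 1) (by simp), ?_⟩
  rw [Finset.sum_mul_sum, Finset.sum_comm, ← Finset.sum_const, Finset.sum_filter]
  refine Finset.sum_congr rfl fun w _ => ?_
  split_ifs with hw <;> simp [gδ_mul_gδ, hw, hsum]

variable {k G : Type*} [Field k] [CharZero k] [Group G] [Fintype G] {Λ : QuantumDouble k G}
  (V : Type*) [AddCommGroup V] [Module k V] [FiniteDimensional k V]
  [Module (QuantumDouble k G) V] [IsScalarTower k (QuantumDouble k G) V]

theorem frobeniusSchurIndicator_mem_fieldRange (hG : IsFSZ G) (hΛ : IsLeftIntegral k Λ)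
    (hΛ₁ : Coalgebra.counit (R := k) Λ = 1) (n : ℕ) :
    frobeniusSchurIndicator k Λ V n ∈ (algebraMap ℚ k).fieldRange := by
  classical
  have hcard : (Fintype.card G : k) ≠ 0 := Nat.cast_ne_zero.2 Fintype.card_ne_zero
  rw [← inv_mul_cancel_left₀ hcard (frobeniusSchurIndicator k Λ V n),
    card_mul_frobeniusSchurIndicator_eq_sum_commonRoots V hΛ hΛ₁]
  refine mul_mem (inv_mem (natCast_mem _ _)) (sum_mem fun y _ => ?_)
  refine sum_nsmul_mem_of_sum_subgroup_mem (fun C => ?_) (hG n y⁻¹)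
  obtain ⟨m, hm, hmul⟩ := exists_sum_gδ_mul_self (k := k) y C
  rw [← map_sum, ← map_sum]
  exact trace_mem_fieldRange_of_mul_self_eq_nsmul hm (by rw [← map_mul, hmul, map_nsmul])

theorem exists_int_frobeniusSchurIndicator (hG : IsFSZ G) (hΛ : IsLeftIntegral k Λ)
    (hΛ₁ : Coalgebra.counit (R := k) Λ = 1) (n : ℕ) :
    ∃ m : ℤ, frobeniusSchurIndicator k Λ V n = m :=
  exists_int_of_isIntegral_of_mem_fieldRange (isIntegral_frobeniusSchurIndicator hΛ hΛ₁ V n)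
    (frobeniusSchurIndicator_mem_fieldRange V hG hΛ hΛ₁ n)

end QuantumDouble

instance QuantumDouble.instModuleFinite {k G : Type*} [CommRing k] [Finite G] :
    Module.Finite k (QuantumDouble k G) :=
  inferInstanceAs (Module.Finite k (G × G →₀ k))

theorem theorem1_general {k G X : Type*} [Field k] [CharZero k] [Group G] [Fintype G] [Finite X]
    {D : Set (Equiv.Perm X)} (hD : ∀ c ∈ D, ∀ d ∈ D, c * d = d * c)
    (e : G ≃* Subgroup.centralizer D) {Λ : QuantumDouble k G} (hΛ : IsLeftIntegral k Λ)
    (hΛ₁ : Coalgebra.counit (R := k) Λ = 1) (V : Type*) [AddCommGroup V] [Module k V]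
    [FiniteDimensional k V] [Module (QuantumDouble k G) V] [IsScalarTower k (QuantumDouble k G) V]
    (n : ℕ) : ∃ m : ℤ, frobeniusSchurIndicator k Λ V n = m :=
  QuantumDouble.exists_int_frobeniusSchurIndicator V ((isFSZ_centralizer hD).of_mulEquiv e) hΛ hΛ₁ n

theorem theorem1 (A : Type*) [CommGroup A] [Finite A] (N : ℕ)
    (Λ : QuantumDouble ℂ (WreathProduct A N)) (hΛ : IsLeftIntegral ℂ Λ)
    (hΛ₁ : Coalgebra.counit (R := ℂ) Λ = 1)
    (V : Type*) [AddCommGroup V] [Module ℂ V] [Module (QuantumDouble ℂ (WreathProduct A N)) V]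
    [IsScalarTower ℂ (QuantumDouble ℂ (WreathProduct A N)) V]
    [IsSimpleModule (QuantumDouble ℂ (WreathProduct A N)) V] (n : ℕ) :
    ∃ m : ℤ, frobeniusSchurIndicator ℂ Λ V n = (m : ℂ) := by
  have : FiniteDimensional ℂ V := Module.Finite.trans (QuantumDouble ℂ (WreathProduct A N)) V
  refine theorem1_general ?_ (WreathProduct.mulEquivCentralizer A N) hΛ hΛ₁ V n
  rintro _ ⟨c, rfl⟩ _ ⟨d, rfl⟩
  exact WreathProduct.translation_mul_comm c d
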